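/- **Setting.** Let $M \ge 2$, let $F$ be a connected compact metric space and let $\psi_1,\dots,\psi_M : F \to F$ be injective strict contractions with $F = \bigcup_{i=1}^M \psi_i(F)$. For a finite word $w = w_1\cdots w_n$ in the alphabet $I = \{1,\dots,M\}$ put $\psi_w = \psi_{w_1}\circ\cdots\circ\psi_{w_n}$, and let $\pi : I^{\mathbb N} \to F$ be given by $\{\pi(\omega)\} = \bigcap_{n} \psi_{\omega_1\cdots\omega_n}(F)$. Assume that $(F,(\psi_i))$ is post-critically finite: the set $P = \bigcup_{n\ge 1}\sigma^n\big(\pi^{-1}(\bigcup_{i\ne j}\psi_i(F)\cap\psi_j(F))\big)$ is finite, where $\sigma$ is the left shift. Let $F^0 = \pi(P)$. Let $(A_0,\mathbf r)$ be a regular irreducible harmonic structure: $\mathbf r = (r_1,\dots,r_M)$ with $0<r_i<1$, and $A_0$ is a symmetric non-positive definite real matrix indexed by $F^0$ whose off-diagonal entries are non-negative and whose kernel consists exactly of the constant functions, such that, with $$\mathcal E_0(u,u) = -u^{T} A_0 u,\qquad \mathcal E_n(f,f) = \sum_{w\in I^n} \frac{1}{r_{w_1}\cdots r_{w_n}}\,\mathcal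 E_0\big(f\circ\psi_w|_{F^0},f\circ\psi_w|_{F^0}\big),$$ one has $\mathcal E_0(u,u) = \min\{\mathcal E_1(v,v) : v|_{F^0} = u\}$ for every $u : F^0\to\mathbb R$. Let $d_H>0$ be the unique number with $\sum_{i} r_i^{d_H} = 1$. For $f\in C(F)$ let $\mathcal E(f,f) = \sup_n \mathcal E_n(f,f) = \lim_n\mathcal E_n(f,f)\in[0,\infty]$, let $\mathcal D = \{f\in C(F) : \mathcal E(f,f)<\infty\}$, and let $R$ be the resistance metric on $F$, $$R(x,y) = \big(\inf\{\mathcal E(f,f) : f\in\mathcal D,\ f(x)=0,\ f(y)=1\}\big)^{-1}$$ (so $R(x,x) = 0$). **Theorem (First continuity theorem).** Let $(E,\Delta)$ be a complete separable metric space, let $\xi = (\xi_x)_{x\in F}$ be a family of $E$-valued random variables on a probability space, and let $C,\beta,\gamma>0$ be such that $$\mathbb E\big[\Delta(\xi_x,\xi_y)^\beta\big] \le C\,R(x,y)^{d_H+\gamma}\qquad\text{for all } x,y\in F.$$ Then $\xi$ has a version (a family $(\eta_x)_{x\in F}$ of $E$-valued random variables on the same probability space with $\eta_x = \xi_x$ almost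 surely for each $x\in F$) which is almost surely essentially $\frac{\gamma}{\beta}$-Hölder continuous with respect to $R$: for almost every $\omega$ and every $\theta\in(0,\frac\gamma\beta)$ there is a finite constant $K$, depending on $\omega$ and $\theta$, such that $\Delta(\eta_x(\omega),\eta_y(\omega)) \le K\,R(x,y)^\theta$ for all $x,y\in F$. -/

import Mathlib

open MeasureTheory Set
open scoped ENNReal NNReal Matrix

namespace PCF

/-- A self-similar set: a compact connected metric space `F` (non-empty, as `ConnectedSpace`
says) which is the union of its images under `M ≥ 2` injective strict contractions. -/
structure SelfSimilarSet (F : Type*) [MetricSpace F] [CompactSpace F] [ConnectedSpace F]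
    (M : ℕ) where
  two_le : 2 ≤ M
  ψ : Fin M → F → F
  injective : ∀ i, Function.Injective (ψ i)
  contracting : ∀ i, ∃ K : ℝ≥0, ContractingWith K (ψ i)
  iUnion_range : ⋃ i, range (ψ i) = univ

namespace SelfSimilarSet

variable {F : Type*} [MetricSpace F] [CompactSpace F] [ConnectedSpace F] {M : ℕ}

/-- `ψ_w = ψ_{w₁} ∘ ⋯ ∘ ψ_{wₙ}` for a finite word `w`. -/
def wordMap (S : SelfSimilarSet F M) : List (Fin M) → F → F
  | [] => id
  | i :: w => S.ψ i ∘ wordMap S w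

/-- The cell `F_w = ψ_w(F)`. -/
def cell (S : SelfSimilarSet F M) (w : List (Fin M)) : Set F := range (S.wordMap w)

/-- The word made of the first `n` letters of the infinite word `ω`. -/
def pre (ω : ℕ → Fin M) (n : ℕ) : List (Fin M) := List.ofFn fun i : Fin n => ω i

theorem wordMap_append (S : SelfSimilarSet F M) (v w : List (Fin M)) :
    S.wordMap (v ++ w) = S.wordMap v ∘ S.wordMap w := by
  induction v with
  | nil => rfl
  | cons i v ih => simp [wordMap, ih, Function.comp_assoc]

theorem pre_succ (ω : ℕ → Fin M) (n : ℕ) : pre ω (n + 1) = pre ω n ++ [ω n] := by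
  rw [pre, List.ofFn_succ_last]
  simp [pre]

theorem exists_lipschitz (S : SelfSimilarSet F M) :
    ∃ K : ℝ≥0, K < 1 ∧ ∀ w : List (Fin M), LipschitzWith (K ^ w.length) (S.wordMap w) := by
  choose K hK using S.contracting
  refine ⟨Finset.univ.sup K, ?_, fun w => ?_⟩
  · exact (Finset.sup_lt_iff (by simp)).2 fun i _ => (hK i).1
  · induction w with
    | nil => simpa [wordMap] using LipschitzWith.id
    | cons i w ih =>
      have h := ((hK i).2.weaken (Finset.le_sup (f := K) (Finset.mem_univ i))).comp ih
      rw [List.length_cons, pow_succ']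
      exact h

/-- The cells along an infinite word shrink to exactly one point. -/
theorem existsUnique_code (S : SelfSimilarSet F M) (ω : ℕ → Fin M) :
    ∃! x : F, ∀ n, x ∈ S.cell (pre ω n) := by
  obtain ⟨K, hK, hL⟩ := S.exists_lipschitz
  have hcpt : ∀ n, IsCompact (S.cell (pre ω n)) := fun n =>
    isCompact_range (hL _).continuous
  obtain ⟨x, hx⟩ := IsCompact.nonempty_iInter_of_sequence_nonempty_isCompact_isClosed
    (fun n => S.cell (pre ω n))
    (fun n => by
      rintro _ ⟨y, rfl⟩
      refine ⟨S.ψ (ω n) y, ?_⟩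
      simp [pre_succ, wordMap_append, wordMap])
    (fun n => range_nonempty _) (hcpt 0) (fun n => (hcpt n).isClosed)
  refine ⟨x, fun n => mem_iInter.1 hx n, fun y hy => ?_⟩
  have hdist : ∀ n : ℕ, dist y x ≤ (K : ℝ) ^ n * Metric.diam (univ : Set F) := fun n => by
    obtain ⟨a, ha⟩ := hy n
    obtain ⟨b, hb⟩ := mem_iInter.1 hx n
    have h := (hL (pre ω n)).dist_le_mul a b
    rw [ha, hb] at h
    have hab : dist a b ≤ Metric.diam (univ : Set F) :=
      Metric.dist_le_diam_of_mem isCompact_univ.isBounded (mem_univ a) (mem_univ b)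
    have hlen : (pre ω n).length = n := by simp [pre]
    rw [hlen] at h
    push_cast at h
    exact h.trans (mul_le_mul_of_nonneg_left hab (by positivity))
  have hlim : Filter.Tendsto (fun n : ℕ => (K : ℝ) ^ n * Metric.diam (univ : Set F))
      Filter.atTop (nhds 0) := by
    simpa using (tendsto_pow_atTop_nhds_zero_of_lt_one K.2 (by exact_mod_cast hK)).mul_const
      (Metric.diam (univ : Set F))
  exact dist_le_zero.1 (ge_of_tendsto' hlim hdist)

/-- The canonical surjection `π` from infinite words to `F`: `{π ω} = ⋂ₙ F_{ω₁…ωₙ}`. -/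
noncomputable def code (S : SelfSimilarSet F M) (ω : ℕ → Fin M) : F :=
  (S.existsUnique_code ω).choose

/-- The critical set `π⁻¹(⋃_{i ≠ j} F_i ∩ F_j)`. -/
def criticalSet (S : SelfSimilarSet F M) : Set (ℕ → Fin M) :=
  {ω | ∃ i j, i ≠ j ∧ S.code ω ∈ range (S.ψ i) ∩ range (S.ψ j)}

/-- The post-critical set `P = ⋃_{n ≥ 1} σⁿ(criticalSet)`, where `σ` is the left shift. -/
def postCriticalSet (S : SelfSimilarSet F M) : Set (ℕ → Fin M) :=
  {ω | ∃ n, 1 ≤ n ∧ ∃ τ ∈ S.criticalSet, ω = fun k => τ (k + n)}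

end SelfSimilarSet

/-- A connected post-critically finite self-similar set. -/
structure PCFSelfSimilarSet (F : Type*) [MetricSpace F] [CompactSpace F] [ConnectedSpace F]
    (M : ℕ) extends SelfSimilarSet F M where
  finite_postCriticalSet : toSelfSimilarSet.postCriticalSet.Finite

/-- Laplacians on a finite set `V`: symmetric non-positive definite matrices whose kernel
is the constants (this is the irreducibility) and whose off-diagonal entries are non-negative. -/
structure IsLaplacian {V : Type*} [Fintype V] (A : Matrix V V ℝ) : Prop where
  symm : A.IsSymm
  nonpos : ∀ u : V → ℝ, u ⬝ᵥ (A *ᵥ u) ≤ 0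
  ker : ∀ u : V → ℝ, A *ᵥ u = 0 ↔ ∃ c : ℝ, u = fun _ => c
  offDiag : ∀ p q, p ≠ q → 0 ≤ A p q

namespace PCFSelfSimilarSet

variable {F : Type*} [MetricSpace F] [CompactSpace F] [ConnectedSpace F] {M : ℕ}

/-- The boundary `F⁰ = π(P)`. -/
def boundary (S : PCFSelfSimilarSet F M) : Set F := S.code '' S.postCriticalSet

noncomputable instance (S : PCFSelfSimilarSet F M) : Fintype S.boundary :=
  (S.finite_postCriticalSet.image S.code).fintype

/-- The quadratic form `𝓔₀(u,u) = -uᵀ A u` on functions on the boundary. -/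
noncomputable def boundaryEnergy (S : PCFSelfSimilarSet F M)
    (A : Matrix S.boundary S.boundary ℝ) (u : S.boundary → ℝ) : ℝ :=
  -(u ⬝ᵥ (A *ᵥ u))

/-- The level-`n` quadratic form `𝓔ₙ(f,f) = ∑_{|w| = n} r_w⁻¹ 𝓔₀(f ∘ ψ_w, f ∘ ψ_w)`. It depends
only on the values of `f` on `Fⁿ = ⋃_{|w| = n} ψ_w(F⁰)`. -/
noncomputable def levelEnergy (S : PCFSelfSimilarSet F M)
    (A : Matrix S.boundary S.boundary ℝ) (r : Fin M → ℝ) (n : ℕ) (f : F → ℝ) : ℝ :=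
  ∑ w : Fin n → Fin M, (∏ k, r (w k))⁻¹ *
    S.boundaryEnergy A fun p => f (S.wordMap (List.ofFn w) p)

end PCFSelfSimilarSet

/-- A regular irreducible harmonic structure `(A₀, r)`: a Laplacian on `F⁰` and weights in `(0,1)`
such that `𝓔₀(u,u) = min {𝓔₁(v,v) : v = u on F⁰}` for every `u` on `F⁰`. -/
structure RegularHarmonicStructure {F : Type*} [MetricSpace F] [CompactSpace F]
    [ConnectedSpace F] {M : ℕ} (S : PCFSelfSimilarSet F M) where
  A : Matrix S.boundary S.boundary ℝ
  r : Fin M → ℝ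
  isLaplacian : IsLaplacian A
  r_pos : ∀ i, 0 < r i
  r_lt_one : ∀ i, r i < 1
  compatible : ∀ u : S.boundary → ℝ,
    IsLeast {e : ℝ | ∃ v : F → ℝ, (∀ p : S.boundary, v p = u p) ∧ e = S.levelEnergy A r 1 v}
      (S.boundaryEnergy A u)

namespace RegularHarmonicStructure

variable {F : Type*} [MetricSpace F] [CompactSpace F] [ConnectedSpace F] {M : ℕ}
  {S : PCFSelfSimilarSet F M}

theorem existsUnique_dim (H : RegularHarmonicStructure S) :
    ∃! d : ℝ, 0 < d ∧ ∑ i, H.r i ^ d = 1 := by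
  have hM : (2 : ℝ) ≤ M := by exact_mod_cast S.two_le
  have : Nonempty (Fin M) := ⟨⟨0, by have := S.two_le; omega⟩⟩
  have hanti : StrictAnti fun d : ℝ => ∑ i, H.r i ^ d := fun a b hab =>
    Finset.sum_lt_sum_of_nonempty Finset.univ_nonempty fun i _ =>
      Real.rpow_lt_rpow_of_exponent_gt (H.r_pos i) (H.r_lt_one i) hab
  have hcont : Continuous fun d : ℝ => ∑ i, H.r i ^ d :=
    continuous_finsetSum _ fun i _ => Real.continuous_const_rpow (H.r_pos i).ne'
  have hlim : Filter.Tendsto (fun d : ℝ => ∑ i, H.r i ^ d) Filter.atTop (nhds 0) := by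
    simpa using tendsto_finsetSum Finset.univ fun i _ =>
      tendsto_rpow_atTop_of_base_lt_one (H.r i) (by linarith [H.r_pos i]) (H.r_lt_one i)
  obtain ⟨b, hb, hb0⟩ := ((hlim.eventually (gt_mem_nhds (zero_lt_one' ℝ))).and
    (Filter.eventually_ge_atTop 0)).exists
  obtain ⟨d, hd, hd1⟩ := intermediate_value_Icc' hb0 hcont.continuousOn
    (show (1 : ℝ) ∈ Icc _ _ from ⟨hb.le, by simpa using (by linarith : (1 : ℝ) ≤ M)⟩)
  refine ⟨d, ⟨lt_of_le_of_ne hd.1 ?_, hd1⟩, fun e he => hanti.injective (he.2.trans hd1.symm)⟩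
  rintro rfl
  simp at hd1
  rw [hd1] at hM
  norm_num at hM

/-- The number `d_H > 0` with `∑ᵢ rᵢ ^ d_H = 1`. -/
noncomputable def dH (H : RegularHarmonicStructure S) : ℝ := H.existsUnique_dim.choose

/-- The energy `𝓔(f,f)` of a continuous function, as the supremum (which is the limit) of the
non-decreasing sequence `𝓔ₙ(f,f)`; infinite when `f` is not in the domain. -/
noncomputable def energy (H : RegularHarmonicStructure S) (f : C(F, ℝ)) : ℝ≥0∞ :=
  ⨆ n : ℕ, ENNReal.ofReal (S.levelEnergy H.A H.r n f)

/-- The domain `𝓓` of the form: continuous functions of finite energy. -/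
def domain (H : RegularHarmonicStructure S) : Set C(F, ℝ) := {f | H.energy f < ∞}

/-- The resistance metric
`R(x,y) = (inf {𝓔(f,f) : f ∈ 𝓓, f(x) = 0, f(y) = 1})⁻¹`, with `R(x,x) = ∞⁻¹ = 0`. -/
noncomputable def resistance (H : RegularHarmonicStructure S) (x y : F) : ℝ≥0∞ :=
  (⨅ f ∈ {f : C(F, ℝ) | f ∈ H.domain ∧ f x = 0 ∧ f y = 1}, H.energy f)⁻¹

end RegularHarmonicStructure

/-- `f` is essentially `δ`-Hölder continuous with respect to the distance `d` on `X`: it is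
`θ`-Hölder continuous for every `θ ∈ (0, δ)` (hence continuous, if `δ > 0`). -/
def EssentiallyHolder {X E : Type*} [PseudoEMetricSpace E] (d : X → X → ℝ≥0∞) (δ : ℝ)
    (f : X → E) : Prop :=
  ∀ θ : ℝ, 0 < θ → θ < δ → ∃ K : ℝ≥0, ∀ x y, edist (f x) (f y) ≤ K * d x y ^ θ

end PCF

/-! ### Kolmogorov's continuity theorem by chaining along nets. -/

namespace KolmogorovChaining

open Filter Topology

/-! Kolmogorov's theorem needs only a bounded pseudometric with nets of polynomial size, so the task
is to supply these for R. By its variational description, √R is the best constant b in |f x - f y| ≤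
b √𝓔(f,f); hence √R satisfies the triangle inequality at once. Passing from R to √R doubles d_H, γ
and θ.

Boundedness (`exists_sq_sub_le`): the energy controls the jump from a boundary point p to ψ_i p,
because the graph of the Laplacian is connected and, F being connected, the cells hang together at
images of boundary points. Composing with ψ_i multiplies the energy by at most r_i, so descending
through the cells costs a geometric series; continuity of f disposes of the remainder.

Nets (`exists_resistance_net`): ψ_i contracts R by the factor r_i, so covering numbers satisfy N(ε)
≤ ∑ N(ε / r_i), and ∑ r_i ^ d_H = 1 says that ε ^ (-d_H) solves this recursion.

Chaining (`exists_holder_version`): pair reduction leaves a number of pairs per scale proportional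
to the size of the net, so the weighted sum of their moments converges for every exponent below the
critical one. The limit along the nets is the version. -/

theorem summable_rpow_mul_geometric (q : ℝ) {ρ : ℝ} (h0 : 0 < ρ) (h1 : ρ < 1) :
    Summable fun n : ℕ => ((n : ℝ) + 1) ^ q * ρ ^ n := by
  have hs := (summable_nat_add_iff 1).2 (summable_pow_mul_geometric_of_norm_lt_one
    (R := ℝ) ⌈q⌉₊ (r := ρ) (by rwa [Real.norm_of_nonneg h0.le]))
  refine Summable.of_nonneg_of_le (fun n => by positivity) (fun n => ?_) (hs.mul_right ρ⁻¹)
  have : ((n : ℝ) + 1) ^ q ≤ ((n : ℝ) + 1) ^ ⌈q⌉₊ := by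
    rw [← Real.rpow_natCast]
    exact Real.rpow_le_rpow_of_exponent_le (by linarith [n.cast_nonneg (α := ℝ)]) (Nat.le_ceil q)
  calc ((n : ℝ) + 1) ^ q * ρ ^ n ≤ ((n : ℝ) + 1) ^ ⌈q⌉₊ * ρ ^ n := by gcongr
    _ = _ := by push_cast; rw [pow_succ]; field_simp

section Deterministic

variable {T E : Type*} [PseudoMetricSpace T] [MetricSpace E]
  {A : ℕ → Finset T} {p : ℕ → T → T} {D₀ : ℝ} {f : T → E} {K r : ℝ}

theorem dist_step_le (hpA : ∀ n t, p n t ∈ A n) (hp : ∀ n t, dist t (p n t) ≤ D₀ * (1 / 2) ^ n)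
    (hD : 0 ≤ D₀)
    (hosc : ∀ n, ∀ s t, (s ∈ A n ∨ s ∈ A (n + 1)) → (t ∈ A n ∨ t ∈ A (n + 1)) →
      dist s t ≤ 4 * D₀ * (1 / 2) ^ n → dist (f s) (f t) ≤ K * r ^ n) (t : T) (n : ℕ) :
    dist (f (p n t)) (f (p (n + 1) t)) ≤ K * r ^ n := by
  refine hosc n _ _ (.inl (hpA n t)) (.inr (hpA (n + 1) t)) ?_
  have h1 := hp n t
  have h2 := hp (n + 1) t
  have h3 := dist_triangle_left (p n t) (p (n + 1) t) t
  rw [pow_succ] at h2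
  have : 0 ≤ D₀ * (1 / 2) ^ n := by positivity
  linarith

theorem exists_tendsto_of_chaining [CompleteSpace E] (hpA : ∀ n t, p n t ∈ A n)
    (hp : ∀ n t, dist t (p n t) ≤ D₀ * (1 / 2) ^ n) (hD : 0 ≤ D₀) (hr : r < 1)
    (hosc : ∀ n, ∀ s t, (s ∈ A n ∨ s ∈ A (n + 1)) → (t ∈ A n ∨ t ∈ A (n + 1)) →
      dist s t ≤ 4 * D₀ * (1 / 2) ^ n → dist (f s) (f t) ≤ K * r ^ n) (t : T) :
    ∃ y, Tendsto (fun n => f (p n t)) atTop (𝓝 y) :=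
  cauchySeq_tendsto_of_complete
    (cauchySeq_of_le_geometric r K hr (dist_step_le hpA hp hD hosc t))

/-- Two points at distance about D₀ 2⁻ⁿ are compared through their level-n approximations: two
geometric tails plus one oscillation, all of order r ^ n. -/
theorem holder_of_chaining {θ : ℝ} (hθ : 0 < θ) (hpA : ∀ n t, p n t ∈ A n)
    (hp : ∀ n t, dist t (p n t) ≤ D₀ * (1 / 2) ^ n) (hD : 0 < D₀)
    (hdiam : ∀ s t : T, dist s t ≤ D₀) (hK : 0 ≤ K)
    (hosc : ∀ n, ∀ s t, (s ∈ A n ∨ s ∈ A (n + 1)) → (t ∈ A n ∨ t ∈ A (n + 1)) →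
      dist s t ≤ 4 * D₀ * (1 / 2) ^ n → dist (f s) (f t) ≤ K * ((1 / 2 : ℝ) ^ θ) ^ n)
    {g : T → E} (hg : ∀ t, Tendsto (fun n => f (p n t)) atTop (𝓝 (g t))) :
    ∃ L : ℝ, 0 ≤ L ∧ ∀ s t, dist (g s) (g t) ≤ L * dist s t ^ θ := by
  set r : ℝ := (1 / 2 : ℝ) ^ θ with hrdef
  have hr0 : 0 < r := by positivity
  have hr1 : r < 1 := Real.rpow_lt_one (by norm_num) (by norm_num) hθ
  have h1r : 0 < 1 - r := by linarith
  set K' : ℝ := 2 * (K / (1 - r)) + K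
  have hK' : 0 ≤ K' := by positivity
  have hlim : ∀ t n, dist (f (p n t)) (g t) ≤ K * r ^ n / (1 - r) := fun t n =>
    dist_le_of_le_geometric_of_tendsto r K hr1 (dist_step_le hpA hp hD.le hosc t) (hg t) n
  have hscale : ∀ s t n, dist s t ≤ D₀ * (1 / 2) ^ n → dist (g s) (g t) ≤ K' * r ^ n := by
    intro s t n hst
    have h1 := hlim s n
    have h2 := hlim t n
    have h3 : dist (f (p n s)) (f (p n t)) ≤ K * r ^ n := by
      refine hosc n _ _ (.inl (hpA n s)) (.inl (hpA n t)) ?_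
      have := dist_triangle4 (p n s) s t (p n t)
      rw [dist_comm (p n s) s] at this
      have h4 := hp n s
      have h5 := hp n t
      have : 0 ≤ D₀ * (1 / 2) ^ n := by positivity
      linarith
    have h4 := dist_triangle4 (g s) (f (p n s)) (f (p n t)) (g t)
    rw [dist_comm (g s) (f (p n s))] at h4
    have : K' * r ^ n = 2 * (K * r ^ n / (1 - r)) + K * r ^ n := by
      simp only [K']; ring
    linarith
  refine ⟨K' * (2 / D₀) ^ θ, by positivity, fun s t => ?_⟩
  -- In a pseudometric, distinct points may have distance 0; then the bound holds at every scale n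
  -- and forces `g s = g t`.
  rcases (dist_nonneg (x := s) (y := t)).eq_or_lt' with h0 | h0
  · have hz : Tendsto (fun n : ℕ => K' * r ^ n) atTop (𝓝 0) := by
      simpa using (tendsto_pow_atTop_nhds_zero_of_lt_one hr0.le hr1).const_mul K'
    have := ge_of_tendsto' hz fun n => hscale s t n (by rw [h0]; positivity)
    exact this.trans (by positivity)
  · obtain ⟨n, hn1, hn2⟩ := exists_nat_pow_near_of_lt_one (x := dist s t / D₀) (y := (1 / 2 : ℝ))
      (by positivity) ((div_le_one hD).2 (hdiam s t)) (by norm_num) (by norm_num)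
    have h2 : dist s t ≤ D₀ * (1 / 2) ^ n := by
      rw [div_le_iff₀ hD] at hn2; linarith
    refine (hscale s t n h2).trans ?_
    rw [mul_assoc]
    refine mul_le_mul_of_nonneg_left ?_ hK'
    rw [← Real.mul_rpow (by positivity) dist_nonneg, hrdef, ← Real.rpow_natCast,
      ← Real.rpow_mul (by norm_num), mul_comm θ, Real.rpow_mul (by norm_num), Real.rpow_natCast]
    refine Real.rpow_le_rpow (by positivity) ?_ hθ.le
    rw [pow_succ] at hn1
    calc (1 / 2 : ℝ) ^ n = 2 * ((1 / 2) ^ n * (1 / 2)) := by ring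
      _ ≤ 2 * (dist s t / D₀) := by linarith
      _ = _ := by ring

end Deterministic

section Random

variable {T E Ω : Type*} [MetricSpace E] [SecondCountableTopology E]
    [MeasurableSpace E] [BorelSpace E] [MeasurableSpace Ω] {P : Measure Ω} {X : T → Ω → E}

/-- The sum over all n and all pairs of r ^ (-βn) times the β-th power of the increment has finite
expectation, so it is almost surely finite. It dominates each of its terms, and its β-th root serves
as `L`. -/
theorem ae_exists_dist_le_geometric (hX : ∀ t, Measurable (X t)) {β : ℝ} (hβ : 0 < β)
    (J : ℕ → Finset (T × T)) (v : ℕ → ℝ) (hv0 : ∀ n, 0 ≤ v n) {r : ℝ} (hr : 0 < r)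
    (hv : ∀ n, ∀ z ∈ J n, ∫⁻ ω, edist (X z.1 ω) (X z.2 ω) ^ β ∂P ≤ ENNReal.ofReal (v n))
    (hsum : Summable fun n => ((J n).card : ℝ) * v n * (r ^ (-β)) ^ n) :
    ∀ᵐ ω ∂P, ∃ L : ℝ, 0 ≤ L ∧ ∀ n, ∀ z ∈ J n, dist (X z.1 ω) (X z.2 ω) ≤ L * r ^ n := by
  set b : ℝ := r ^ (-β) with hb
  have hb0 : 0 < b := by positivity
  set Z : ℕ → Ω → ℝ≥0∞ := fun n ω =>
    (∑ z ∈ J n, edist (X z.1 ω) (X z.2 ω) ^ β) * ENNReal.ofReal (b ^ n)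
  have hmd : ∀ z : T × T, Measurable fun ω => edist (X z.1 ω) (X z.2 ω) ^ β := fun z =>
    ((hX z.1).edist (hX z.2)).pow_const β
  have hmZ : ∀ n, Measurable (Z n) := fun n =>
    (Finset.measurable_sum _ fun z _ => hmd z).mul_const _
  have hint : ∀ n, ∫⁻ ω, Z n ω ∂P ≤ ENNReal.ofReal (((J n).card : ℝ) * v n * b ^ n) := by
    intro n
    simp only [Z]
    rw [lintegral_mul_const _ (Finset.measurable_sum _ fun z _ => hmd z),
      lintegral_finsetSum _ fun z _ => hmd z, ENNReal.ofReal_mul (by have := hv0 n; positivity),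
      ENNReal.ofReal_mul (by positivity), ENNReal.ofReal_natCast]
    gcongr
    refine (Finset.sum_le_card_nsmul _ _ _ (hv n)).trans_eq ?_
    rw [nsmul_eq_mul]
  have hfin : ∫⁻ ω, ∑' n, Z n ω ∂P ≠ ∞ := by
    rw [lintegral_tsum fun n => (hmZ n).aemeasurable]
    exact ne_top_of_le_ne_top hsum.tsum_ofReal_ne_top (ENNReal.tsum_le_tsum hint)
  filter_upwards [ae_lt_top (Measurable.tsum hmZ) hfin] with ω hω
  set s := ∑' n, Z n ω
  refine ⟨s.toReal ^ (1 / β), by positivity, fun n z hz => ?_⟩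
  have h1 : edist (X z.1 ω) (X z.2 ω) ^ β * ENNReal.ofReal (b ^ n) ≤ s := by
    refine le_trans ?_ (ENNReal.le_tsum n)
    simp only [Z]
    gcongr
    exact Finset.single_le_sum (f := fun z : T × T => edist (X z.1 ω) (X z.2 ω) ^ β)
      (fun _ _ => zero_le) hz
  rw [edist_dist, ENNReal.ofReal_rpow_of_nonneg dist_nonneg hβ.le, ← ENNReal.ofReal_mul
    (by positivity), ENNReal.ofReal_le_iff_le_toReal hω.ne] at h1
  have h2 : (dist (X z.1 ω) (X z.2 ω) * (r ^ n)⁻¹) ^ β ≤ s.toReal := by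
    rw [Real.mul_rpow dist_nonneg (by positivity)]
    convert h1 using 2
    rw [hb, Real.inv_rpow (by positivity), Real.rpow_neg hr.le, inv_pow, ← Real.rpow_natCast,
      ← Real.rpow_natCast, ← Real.rpow_mul hr.le, ← Real.rpow_mul hr.le, mul_comm]
  have h3 : dist (X z.1 ω) (X z.2 ω) * (r ^ n)⁻¹ ≤ s.toReal ^ (1 / β) := by
    rw [one_div]
    exact (Real.le_rpow_inv_iff_of_pos (by positivity) (by positivity) hβ).2 h2
  rwa [← div_eq_mul_inv, div_le_iff₀ (by positivity)] at h3

variable [PseudoMetricSpace T]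

theorem ae_exists_dist_le_of_moment (hX : ∀ t, Measurable (X t)) {β γ D C : ℝ} (hβ : 0 < β)
    (hγ : 0 < γ) (hD : 0 ≤ D) (hC : 0 ≤ C)
    (hmom : ∀ s t, ∫⁻ ω, edist (X s ω) (X t ω) ^ β ∂P ≤ ENNReal.ofReal (C * dist s t ^ (D + γ)))
    (J : ℕ → Finset (T × T)) {c k : ℝ} (hk : 0 ≤ k)
    (hcard : ∀ n, ((J n).card : ℝ) ≤ c * ((2 : ℝ) ^ D) ^ n)
    (hdist : ∀ n, ∀ z ∈ J n, dist z.1 z.2 ≤ k * (n + 1) * (1 / 2) ^ n)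
    {θ : ℝ} (hθ : θ < γ / β) :
    ∀ᵐ ω ∂P, ∃ L : ℝ, 0 ≤ L ∧ ∀ n, ∀ z ∈ J n,
      dist (X z.1 ω) (X z.2 ω) ≤ L * ((1 / 2 : ℝ) ^ θ) ^ n := by
  refine ae_exists_dist_le_geometric hX hβ J
    (fun n => C * (k * (n + 1) * (1 / 2) ^ n) ^ (D + γ)) (fun n => by positivity) (by positivity)
    (fun n z hz => (hmom _ _).trans (ENNReal.ofReal_le_ofReal ?_)) ?_
  · have := hdist n z hz
    gcongr
  -- The growth 2 ^ (Dn) of the number of pairs cancels against the moment exponent, leaving ρ = 2 ^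
  -- (-(γ - θβ)) < 1. The factor n + 1 in the distances costs only a polynomial.
  set ρ : ℝ := (2 : ℝ) ^ D * (1 / 2) ^ (D + γ) * ((1 / 2 : ℝ) ^ θ) ^ (-β) with hρ
  have hρ1 : ρ < 1 := by
    have : ρ = (1 / 2 : ℝ) ^ (γ - θ * β) := by
      have h2 : (2 : ℝ) ^ D = (1 / 2) ^ (-D) := by
        rw [one_div, Real.inv_rpow (by norm_num), ← Real.rpow_neg (by norm_num), neg_neg]
      rw [hρ, ← Real.rpow_mul (by norm_num), h2, ← Real.rpow_add (by norm_num), ← Real.rpow_add (by norm_num)]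
      congr 1
      ring
    rw [this]
    refine Real.rpow_lt_one (by norm_num) (by norm_num) ?_
    rw [lt_div_iff₀ hβ] at hθ
    linarith
  refine Summable.of_nonneg_of_le (fun n => by positivity) (fun n => ?_)
    ((summable_rpow_mul_geometric (D + γ) (by positivity : 0 < ρ) hρ1).mul_left
      (c * C * k ^ (D + γ)))
  calc ((J n).card : ℝ) * (C * (k * (n + 1) * (1 / 2) ^ n) ^ (D + γ)) *
        (((1 / 2 : ℝ) ^ θ) ^ (-β)) ^ n
      ≤ (c * ((2 : ℝ) ^ D) ^ n) * (C * (k * (n + 1) * (1 / 2) ^ n) ^ (D + γ)) *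
        (((1 / 2 : ℝ) ^ θ) ^ (-β)) ^ n := by
        gcongr
        exact hcard n
    _ = _ := by
        rw [Real.mul_rpow (by positivity) (by positivity),
          Real.mul_rpow (by positivity) (by positivity), hρ, mul_pow, mul_pow,
          ← Real.rpow_natCast (1 / 2 : ℝ) n, ← Real.rpow_mul (by norm_num), mul_comm (n : ℝ),
          Real.rpow_mul (by norm_num), Real.rpow_natCast]
        ring

/-- Oscillations of the process along the nets decay geometrically, with probability one. -/
theorem ae_exists_chaining_bound (hX : ∀ t, Measurable (X t)) {β γ D C : ℝ} (hβ : 0 < β)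
    (hγ : 0 < γ) (hD : 0 ≤ D) (hC : 0 ≤ C)
    (hmom : ∀ s t, ∫⁻ ω, edist (X s ω) (X t ω) ^ β ∂P ≤ ENNReal.ofReal (C * dist s t ^ (D + γ)))
    {A : ℕ → Finset T} {c : ℝ} (hc : 1 ≤ c)
    (hcard : ∀ n, ((A n).card : ℝ) ≤ c * ((2 : ℝ) ^ D) ^ n) {k : ℝ} (hk : 0 ≤ k)
    {θ : ℝ} (hθ : θ < γ / β) :
    ∀ᵐ ω ∂P, ∃ L : ℝ, 0 ≤ L ∧ ∀ n, ∀ s t, (s ∈ A n ∨ s ∈ A (n + 1)) →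
      (t ∈ A n ∨ t ∈ A (n + 1)) → dist s t ≤ k * (1 / 2) ^ n →
      dist (X s ω) (X t ω) ≤ L * ((1 / 2 : ℝ) ^ θ) ^ n := by
  classical
  set a : ℝ := c + c * (2 : ℝ) ^ D with ha
  have h2D : (1 : ℝ) ≤ 2 ^ D := Real.one_le_rpow (by norm_num) hD
  have ha0 : 0 ≤ a := by positivity
  have hunion : ∀ n, ((A n ∪ A (n + 1)).card : ℝ) ≤ a * ((2 : ℝ) ^ D) ^ n := by
    intro n
    have h1 : ((A n ∪ A (n + 1)).card : ℝ) ≤ (A n).card + (A (n + 1)).card := by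
      exact_mod_cast Finset.card_union_le _ _
    have h2 := hcard n
    have h3 := hcard (n + 1)
    rw [pow_succ] at h3
    rw [ha]
    linarith
  -- Pair reduction asks for a power of one base: 2 ^ D ≤ a, and the extra exponent absorbs the
  -- constant a.
  have hpow : ∀ n, ((A n ∪ A (n + 1)).card : ℝ≥0∞) ≤ ENNReal.ofReal a ^ (n + 1) := by
    intro n
    rw [← ENNReal.ofReal_pow ha0, ← ENNReal.ofReal_natCast]
    refine ENNReal.ofReal_le_ofReal ((hunion n).trans ?_)
    rw [pow_succ, mul_comm]
    refine mul_le_mul_of_nonneg_right (pow_le_pow_left₀ (by positivity) ?_ n) ha0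
    nlinarith
  -- Summing over all close pairs would cost the square of the cardinality. At most a times the
  -- cardinality of the union suffice, at distances up to n + 1 times larger, and they control the
  -- supremum up to a factor 2.
  choose J _ hJcard hJdist hJ using fun n =>
    EMetric.pair_reduction (hpow n) (ENNReal.ofReal (k * (1 / 2) ^ n)) E
  have hJcard' : ∀ n, ((J n).card : ℝ) ≤ a * a * ((2 : ℝ) ^ D) ^ n := by
    intro n
    have := hJcard n
    rw [← ENNReal.ofReal_natCast, ← ENNReal.ofReal_natCast, ← ENNReal.ofReal_mul ha0,
      ENNReal.ofReal_le_ofReal_iff (by positivity)] at this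
    rw [mul_assoc]
    exact this.trans (mul_le_mul_of_nonneg_left (hunion n) ha0)
  have hJdist' : ∀ n, ∀ z ∈ J n, dist z.1 z.2 ≤ k * (n + 1) * (1 / 2) ^ n := by
    intro n z hz
    have := hJdist n z.1 z.2 hz
    rw [edist_dist, ← ENNReal.ofReal_natCast, ← ENNReal.ofReal_mul (by positivity),
      ENNReal.ofReal_le_ofReal_iff (by positivity)] at this
    refine this.trans_eq ?_
    push_cast
    ring
  filter_upwards [ae_exists_dist_le_of_moment hX hβ hγ hD hC hmom J hk hJcard' hJdist' hθ] with
    ω ⟨L, hL0, hL⟩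
  refine ⟨2 * L, by positivity, fun n s t hs ht hst => ?_⟩
  have hs' : s ∈ A n ∪ A (n + 1) := Finset.mem_union.2 hs
  have ht' : t ∈ A n ∪ A (n + 1) := Finset.mem_union.2 ht
  have hst' : edist s t ≤ ENNReal.ofReal (k * (1 / 2) ^ n) := by
    rw [edist_dist]; exact ENNReal.ofReal_le_ofReal hst
  have h1 : edist (X s ω) (X t ω) ≤
      2 * ⨆ z : J n, edist (X z.1.1 ω) (X z.1.2 ω) := by
    refine le_trans ?_ (hJ n fun t => X t ω)
    exact le_iSup_of_le (⟨s, hs'⟩ : (A n ∪ A (n + 1) : Finset T)) (le_iSup_of_le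
      ⟨⟨t, ht'⟩, hst'⟩ le_rfl)
  have h2 : edist (X s ω) (X t ω) ≤ ENNReal.ofReal (2 * L * ((1 / 2 : ℝ) ^ θ) ^ n) := by
    refine h1.trans ?_
    rw [mul_assoc, ENNReal.ofReal_mul (by norm_num), ENNReal.ofReal_ofNat]
    gcongr
    refine iSup_le fun z => ?_
    rw [edist_dist]
    exact ENNReal.ofReal_le_ofReal (hL n z.1 z.2)
  rwa [edist_dist, ENNReal.ofReal_le_ofReal_iff (by positivity)] at h2

/-- A Kolmogorov continuity theorem on a bounded pseudometric space with nets of polynomially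
growing cardinality. -/
theorem exists_holder_version [CompleteSpace E] [IsProbabilityMeasure P]
    (hX : ∀ t, Measurable (X t)) {β γ D C : ℝ} (hβ : 0 < β)
    (hγ : 0 < γ) (hD : 0 ≤ D) (hC : 0 ≤ C)
    (hmom : ∀ s t, ∫⁻ ω, edist (X s ω) (X t ω) ^ β ∂P ≤ ENNReal.ofReal (C * dist s t ^ (D + γ)))
    {A : ℕ → Finset T} {c : ℝ} (hc : 1 ≤ c)
    (hcard : ∀ n, ((A n).card : ℝ) ≤ c * ((2 : ℝ) ^ D) ^ n) {D₀ : ℝ} (hD₀ : 0 < D₀)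
    (hdiam : ∀ s t : T, dist s t ≤ D₀)
    (hnet : ∀ n, ∀ t, ∃ s ∈ A n, dist t s ≤ D₀ * (1 / 2) ^ n) :
    ∃ Y : T → Ω → E, (∀ t, Measurable (Y t)) ∧ (∀ t, Y t =ᵐ[P] X t) ∧
      ∀ᵐ ω ∂P, ∀ θ : ℝ, 0 < θ → θ < γ / β →
        ∃ L : ℝ, 0 ≤ L ∧ ∀ s t, dist (Y s ω) (Y t ω) ≤ L * dist s t ^ θ := by
  classical
  rcases isEmpty_or_nonempty T with hT | hT
  · exact ⟨X, hX, fun t => .rfl, .of_forall fun ω θ _ _ => ⟨0, le_rfl, fun s => hT.elim s⟩⟩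
  have hΩ : Nonempty Ω := nonempty_of_isProbabilityMeasure P
  obtain ⟨t₀⟩ := hT
  obtain ⟨ω₀⟩ := hΩ
  choose p hpA hp using hnet
  -- Rational exponents make the quantifier countable, so that one null set serves every θ.
  have hosc : ∀ᵐ ω ∂P, ∀ κ : ℚ, (κ : ℝ) < γ / β →
      ∃ L : ℝ, 0 ≤ L ∧ ∀ n, ∀ s t, (s ∈ A n ∨ s ∈ A (n + 1)) →
        (t ∈ A n ∨ t ∈ A (n + 1)) → dist s t ≤ 4 * D₀ * (1 / 2) ^ n →
        dist (X s ω) (X t ω) ≤ L * ((1 / 2 : ℝ) ^ (κ : ℝ)) ^ n := by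
    refine ae_all_iff.2 fun κ => ?_
    by_cases hκ : (κ : ℝ) < γ / β
    · filter_upwards [ae_exists_chaining_bound hX hβ hγ hD hC hmom hc hcard
        (k := 4 * D₀) (by positivity) hκ] with ω hω _ using hω
    · exact .of_forall fun ω h => absurd h hκ
  obtain ⟨κ₀, hκ₀, hκ₀'⟩ := exists_rat_btwn (div_pos hγ hβ)
  obtain ⟨G, hGP, hGm, hG⟩ := hosc.exists_measurable_mem
  have hlt : ∀ κ : ℝ, 0 < κ → (1 / 2 : ℝ) ^ κ < 1 := fun κ hκ =>
    Real.rpow_lt_one (by norm_num) (by norm_num) hκ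
  -- Off the good set the approximations are frozen at an arbitrary value, so the limit exists
  -- everywhere and is measurable.
  set W : ℕ → T → Ω → E := fun n t => G.piecewise (X (p n t)) fun _ => X t₀ ω₀
  have hW : ∀ t ω, ∃ y, Tendsto (fun n => W n t ω) atTop (𝓝 y) := by
    intro t ω
    by_cases hω : ω ∈ G
    · obtain ⟨L, hL0, hL⟩ := hG ω hω κ₀ hκ₀'
      simp only [W, piecewise_eq_of_mem _ _ _ hω]
      exact exists_tendsto_of_chaining (f := fun t => X t ω) hpA hp hD₀.le (hlt _ hκ₀) hL t
    · simp only [W, piecewise_eq_of_notMem _ _ _ hω]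
      exact ⟨_, tendsto_const_nhds⟩
  choose Y hY using hW
  refine ⟨Y, fun t => ?_, fun t => ?_, ?_⟩
  · exact measurable_of_tendsto_metrizable
      (fun n => (hX (p n t)).piecewise hGm measurable_const) (tendsto_pi_nhds.2 (hY t))
  -- With the single pair (p n t, t) at each level, the moment estimate gives X (p n t) → X t almost
  -- surely; limits are unique.
  · have hconv := ae_exists_dist_le_of_moment hX hβ hγ hD hC hmom (fun n => {(p n t, t)})
      (c := c) (k := D₀) hD₀.le
      (fun n => by
        have : (1 : ℝ) ≤ ((2 : ℝ) ^ D) ^ n :=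
          one_le_pow₀ (Real.one_le_rpow (by norm_num) hD)
        simp only [Finset.card_singleton, Nat.cast_one]
        nlinarith)
      (fun n z hz => by
        rw [Finset.mem_singleton.1 hz, dist_comm]
        refine (hp n t).trans ?_
        rw [mul_assoc]
        gcongr
        have : (0 : ℝ) ≤ n := n.cast_nonneg
        have h2 : (0 : ℝ) ≤ (1 / 2) ^ n := by positivity
        nlinarith) hκ₀'
    filter_upwards [hconv, hGP] with ω ⟨L, hL0, hL⟩ hω
    have h1 := hY t ω
    simp only [W, piecewise_eq_of_mem _ _ _ hω] at h1
    refine tendsto_nhds_unique h1 (tendsto_iff_dist_tendsto_zero.2 ?_)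
    refine squeeze_zero (fun n => dist_nonneg)
      (fun n => hL n (p n t, t) (Finset.mem_singleton_self _)) ?_
    simpa using (tendsto_pow_atTop_nhds_zero_of_lt_one (by positivity) (hlt _ hκ₀)).const_mul L
  · filter_upwards [hGP] with ω hω θ hθ hθ'
    obtain ⟨κ, hκ, hκ'⟩ := exists_rat_btwn hθ'
    obtain ⟨L, hL0, hL⟩ := hG ω hω κ hκ'
    refine holder_of_chaining (f := fun t => X t ω) (K := L) hθ hpA hp hD₀ hdiam hL0
      (fun n s t hs ht hst => (hL n s t hs ht hst).trans ?_) fun t => ?_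
    · gcongr L * ?_ ^ n
      exact Real.rpow_le_rpow_of_exponent_ge (by norm_num) (by norm_num) hκ.le
    · have h1 := hY t ω
      simpa only [W, piecewise_eq_of_mem _ _ _ hω] using h1

end Random

end KolmogorovChaining

/-! ### Codings, boundary points and gluing of cells. -/

namespace PCF

namespace SelfSimilarSet

variable {F : Type*} [MetricSpace F] [CompactSpace F] [ConnectedSpace F] {M : ℕ}

theorem code_mem (S : SelfSimilarSet F M) (ω : ℕ → Fin M) (n : ℕ) :
    S.code ω ∈ S.cell (pre ω n) :=
  (S.existsUnique_code ω).choose_spec.1 n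

theorem eq_code (S : SelfSimilarSet F M) {ω : ℕ → Fin M} {x : F}
    (h : ∀ n, x ∈ S.cell (pre ω n)) : x = S.code ω :=
  (S.existsUnique_code ω).unique h (S.code_mem ω)

theorem pre_succ' (ω : ℕ → Fin M) (n : ℕ) :
    pre ω (n + 1) = ω 0 :: pre (fun k => ω (k + 1)) n := by
  simp [pre, List.ofFn_succ]

theorem ψ_code (S : SelfSimilarSet F M) (ω : ℕ → Fin M) :
    S.ψ (ω 0) (S.code fun k => ω (k + 1)) = S.code ω := by
  refine S.eq_code fun n => ?_
  cases n with
  | zero => exact ⟨_, rfl⟩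
  | succ n =>
    obtain ⟨y, hy⟩ := S.code_mem (fun k => ω (k + 1)) n
    refine ⟨y, ?_⟩
    rw [pre_succ', ← hy]
    rfl

theorem exists_ψ_eq (S : SelfSimilarSet F M) (x : F) : ∃ i y, S.ψ i y = x := by
  have : x ∈ ⋃ i, range (S.ψ i) := by rw [S.iUnion_range]; trivial
  simpa using this

theorem code_surjective (S : SelfSimilarSet F M) : Function.Surjective S.code := by
  intro x
  choose i y hy using S.exists_ψ_eq
  -- An address of x is read off by repeatedly choosing a cell and a preimage in it.
  refine ⟨fun n => i (y^[n] x), (S.eq_code fun n => ⟨y^[n] x, ?_⟩).symm⟩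
  induction n with
  | zero => rfl
  | succ n ih =>
    rw [pre_succ, wordMap_append, Function.iterate_succ_apply', Function.comp_apply]
    simpa [wordMap, hy] using ih

end SelfSimilarSet

namespace PCFSelfSimilarSet

variable {F : Type*} [MetricSpace F] [CompactSpace F] [ConnectedSpace F] {M : ℕ}
  (S : PCFSelfSimilarSet F M)

/-- Prepending i to an address of y gives a critical address; one shift recovers that of y. -/
theorem mem_boundary_of_ψ_mem_inter {i j : Fin M} (hij : i ≠ j) {y : F}
    (h : S.ψ i y ∈ range (S.ψ i) ∩ range (S.ψ j)) : y ∈ S.boundary := by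
  obtain ⟨τ, rfl⟩ := S.code_surjective y
  let ω : ℕ → Fin M := fun n => Nat.casesOn n i τ
  have hω : S.code ω = S.ψ i (S.code τ) := (S.ψ_code ω).symm
  exact ⟨τ, ⟨1, le_rfl, ω, ⟨i, j, hij, by rwa [hω]⟩, rfl⟩, rfl⟩

/-- A boundary point lies in the image of the boundary under one of the contractions. -/
theorem exists_ψ_eq_of_mem_boundary {x : F} (hx : x ∈ S.boundary) :
    ∃ i, ∃ y ∈ S.boundary, S.ψ i y = x := by
  obtain ⟨τ, ⟨n, hn, ω, hω, rfl⟩, rfl⟩ := hx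
  -- The post-critical set is stable under the shift, so dropping the first letter stays inside it.
  refine ⟨_, _, ?_, S.ψ_code _⟩
  exact ⟨_, ⟨n + 1, by omega, ω, hω, rfl⟩, congrArg S.code (by funext k; congr 1; ring)⟩

/-- Two complementary groups of cells meet in images of boundary points. -/
theorem exists_boundary_link (I : Set (Fin M)) (hI : I.Nonempty) (hI' : Iᶜ.Nonempty) :
    ∃ i ∈ I, ∃ j ∈ Iᶜ, ∃ p ∈ S.boundary, ∃ q ∈ S.boundary, S.ψ i p = S.ψ j q := by
  have hclosed : ∀ I : Set (Fin M), IsClosed (⋃ i ∈ I, range (S.ψ i)) := fun I =>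
    I.toFinite.isClosed_biUnion fun i _ =>
      (isCompact_range ((S.contracting i).choose_spec.2.continuous)).isClosed
  have hne : ∀ I : Set (Fin M), I.Nonempty → (⋃ i ∈ I, range (S.ψ i)).Nonempty := by
    rintro I ⟨i, hi⟩
    exact ⟨_, mem_biUnion hi (mem_range_self (Classical.arbitrary F))⟩
  -- The two groups of cells are closed, nonempty and cover the connected space F, so they meet.
  obtain ⟨x, -, hx, hx'⟩ := isPreconnected_closed_iff.1 (isPreconnected_univ (α := F)) _ _
    (hclosed I) (hclosed Iᶜ) (fun x _ => by
      obtain ⟨i, y, rfl⟩ := S.exists_ψ_eq x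
      by_cases hi : i ∈ I
      · exact .inl (mem_biUnion hi (mem_range_self y))
      · exact .inr (mem_biUnion hi (mem_range_self y)))
    (by simpa using hne I hI) (by simpa using hne _ hI')
  obtain ⟨i, hi, p, rfl⟩ := mem_iUnion₂.1 hx
  obtain ⟨j, hj, q, hq⟩ := mem_iUnion₂.1 hx'
  have hij : i ≠ j := by rintro rfl; exact hj hi
  refine ⟨i, hi, j, hj, p, S.mem_boundary_of_ψ_mem_inter hij ⟨mem_range_self _, q, hq⟩, q,
    S.mem_boundary_of_ψ_mem_inter hij.symm ⟨mem_range_self _, p, hq.symm⟩, hq.symm⟩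

theorem boundary_nonempty : S.boundary.Nonempty := by
  have := S.two_le
  obtain ⟨i, -, j, -, p, hp, -⟩ := S.exists_boundary_link
    {(⟨0, by omega⟩ : Fin M)} (singleton_nonempty _) ⟨⟨1, by omega⟩, by simp⟩
  exact ⟨p, hp⟩

theorem levelEnergy_succ (A : Matrix S.boundary S.boundary ℝ) (r : Fin M → ℝ) (n : ℕ)
    (f : F → ℝ) :
    S.levelEnergy A r (n + 1) f = ∑ i, (r i)⁻¹ * S.levelEnergy A r n (f ∘ S.ψ i) := by
  simp only [levelEnergy, Finset.mul_sum]
  rw [← Fintype.sum_prod_type', ← (Fin.consEquiv fun _ : Fin (n + 1) => Fin M).sum_comp]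
  refine Finset.sum_congr rfl fun z _ => ?_
  simp only [Fin.consEquiv_apply, Fin.prod_univ_succ, Fin.cons_zero, Fin.cons_succ, mul_inv,
    mul_assoc]
  have hw : List.ofFn (Fin.consEquiv (fun _ => Fin M) z) = z.1 :: List.ofFn z.2 :=
    List.ofFn_cons _ _
  rw [hw]
  rfl

theorem levelEnergy_zero (A : Matrix S.boundary S.boundary ℝ) (r : Fin M → ℝ) (f : F → ℝ) :
    S.levelEnergy A r 0 f = S.boundaryEnergy A fun p => f p := by
  simp [levelEnergy, SelfSimilarSet.wordMap]

theorem levelEnergy_const_mul_sub (A : Matrix S.boundary S.boundary ℝ) (hA : IsLaplacian A)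
    (r : Fin M → ℝ) (n : ℕ) (f : F → ℝ) (c b : ℝ) :
    S.levelEnergy A r n (fun x => c * (f x - b)) = c ^ 2 * S.levelEnergy A r n f := by
  have hb : ∀ u : S.boundary → ℝ,
      S.boundaryEnergy A (fun p => c * (u p - b)) = c ^ 2 * S.boundaryEnergy A u := by
    intro u
    have hker : A *ᵥ (fun _ => b) = 0 := (hA.ker _).2 ⟨b, rfl⟩
    have hker' : (fun _ => b) ⬝ᵥ (A *ᵥ u) = 0 := by
      rw [Matrix.dotProduct_mulVec, ← Matrix.mulVec_transpose, hA.symm.eq, hker, zero_dotProduct]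
    have : (fun p => c * (u p - b)) = c • (u - fun _ => b) := rfl
    rw [this, boundaryEnergy, boundaryEnergy, Matrix.mulVec_smul, Matrix.mulVec_sub, hker,
      sub_zero, smul_dotProduct, dotProduct_smul, sub_dotProduct, hker', sub_zero]
    simp only [smul_eq_mul]
    ring
  simp only [levelEnergy, Finset.mul_sum]
  refine Finset.sum_congr rfl fun w _ => ?_
  rw [hb fun p => f (S.wordMap (List.ofFn w) p)]
  ring

end PCFSelfSimilarSet

/-! ### Laplacians as weighted graphs. -/

namespace IsLaplacian

variable {V : Type*} [Fintype V] {A : Matrix V V ℝ}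

theorem row_sum (hA : IsLaplacian A) (p : V) : ∑ q, A p q = 0 := by
  have := congrFun ((hA.ker fun _ => 1).2 ⟨1, rfl⟩) p
  simpa [Matrix.mulVec, dotProduct] using this

/-- Rows sum to zero, and by symmetry so do columns; only the cross terms survive. -/
theorem sum_sq_sub (hA : IsLaplacian A) (u : V → ℝ) :
    ∑ p, ∑ q, A p q * (u p - u q) ^ 2 = 2 * -(u ⬝ᵥ (A *ᵥ u)) := by
  have h1 : ∑ p, ∑ q, A p q * u p ^ 2 = 0 := by
    simp_rw [← Finset.sum_mul, hA.row_sum]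
    simp
  have h2 : ∑ p, ∑ q, A p q * u q ^ 2 = 0 := by
    rw [Finset.sum_comm]
    simp_rw [fun p q => hA.symm.apply q p, ← Finset.sum_mul, hA.row_sum]
    simp
  have h3 : u ⬝ᵥ (A *ᵥ u) = ∑ p, ∑ q, A p q * (u p * u q) := by
    simp only [dotProduct, Matrix.mulVec, Finset.mul_sum]
    exact Finset.sum_congr rfl fun p _ => Finset.sum_congr rfl fun q _ => by ring
  calc ∑ p, ∑ q, A p q * (u p - u q) ^ 2
      = ∑ p, ∑ q, A p q * u p ^ 2 + ∑ p, ∑ q, A p q * u q ^ 2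
        - 2 * ∑ p, ∑ q, A p q * (u p * u q) := by
        simp only [Finset.mul_sum, ← Finset.sum_add_distrib, ← Finset.sum_sub_distrib]
        exact Finset.sum_congr rfl fun p _ => Finset.sum_congr rfl fun q _ => by ring
    _ = _ := by rw [h1, h2, h3]; ring

theorem mul_sq_sub_le (hA : IsLaplacian A) (u : V → ℝ) (p q : V) :
    A p q * (u p - u q) ^ 2 ≤ 2 * -(u ⬝ᵥ (A *ᵥ u)) := by
  rw [← hA.sum_sq_sub]
  have h : ∀ p q, 0 ≤ A p q * (u p - u q) ^ 2 := fun p q => by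
    by_cases hpq : p = q
    · simp [hpq]
    · exact mul_nonneg (hA.offDiag p q hpq) (sq_nonneg _)
  exact (Finset.single_le_sum (f := fun q => A p q * (u p - u q) ^ 2) (fun q _ => h p q)
    (Finset.mem_univ q)).trans (Finset.single_le_sum
      (f := fun p => ∑ q, A p q * (u p - u q) ^ 2)
      (fun p _ => Finset.sum_nonneg fun q _ => h p q) (Finset.mem_univ p))

/-- The weighted graph of a Laplacian is connected. -/
theorem eq_univ_of_closed (hA : IsLaplacian A) (U : Set V) (hne : U.Nonempty)
    (hU : ∀ p ∈ U, ∀ q, 0 < A p q → q ∈ U) : U = univ := by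
  classical
  have hzero : ∀ p ∈ U, ∀ q ∉ U, A p q = 0 := fun p hp q hq =>
    le_antisymm (not_lt.1 fun h => hq (hU p hp q h))
      (hA.offDiag p q (by rintro rfl; exact hq hp))
  -- No edge leaves U, so its indicator is harmonic, hence constant.
  have hker : A *ᵥ (U.indicator fun _ => 1) = 0 := by
    funext p
    simp only [Matrix.mulVec, dotProduct, Pi.zero_apply]
    by_cases hp : p ∈ U
    · rw [← hA.row_sum p]
      refine Finset.sum_congr rfl fun q _ => ?_
      by_cases hq : q ∈ U
      · simp [hq]
      · simp [hq, hzero p hp q hq]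
    · refine Finset.sum_eq_zero fun q _ => ?_
      by_cases hq : q ∈ U
      · rw [← hA.symm.apply, hzero q hq p hp, zero_mul]
      · simp [hq]
  obtain ⟨c, hc⟩ := (hA.ker _).1 hker
  obtain ⟨p, hp⟩ := hne
  have h1 : (1 : ℝ) = c := by simpa [hp] using congrFun hc p
  refine eq_univ_of_forall fun q => ?_
  by_contra hq
  have h0 : (0 : ℝ) = c := by simpa [hq] using congrFun hc q
  linarith

end IsLaplacian

/-! ### Energy controls oscillation. -/

namespace RegularHarmonicStructure

variable {F : Type*} [MetricSpace F] [CompactSpace F] [ConnectedSpace F] {M : ℕ}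
  {S : PCFSelfSimilarSet F M} (H : RegularHarmonicStructure S)

theorem levelEnergy_nonneg (n : ℕ) (f : F → ℝ) : 0 ≤ S.levelEnergy H.A H.r n f :=
  Finset.sum_nonneg fun _ _ => mul_nonneg
    (inv_nonneg.2 (Finset.prod_nonneg fun _ _ => (H.r_pos _).le))
    (neg_nonneg.2 (H.isLaplacian.nonpos _))

/-- One nonnegative term of the self-similar decomposition; the source of every scaling by r_i. -/
theorem levelEnergy_comp_le (n : ℕ) (f : F → ℝ) (i : Fin M) :
    S.levelEnergy H.A H.r n (f ∘ S.ψ i) ≤ H.r i * S.levelEnergy H.A H.r (n + 1) f := by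
  rw [S.levelEnergy_succ, ← inv_mul_le_iff₀ (H.r_pos i)]
  exact Finset.single_le_sum
    (f := fun i => (H.r i)⁻¹ * S.levelEnergy H.A H.r n (f ∘ S.ψ i))
    (fun j _ => mul_nonneg (inv_nonneg.2 (H.r_pos j).le) (H.levelEnergy_nonneg n _))
    (Finset.mem_univ i)

/-- The energies of the first two levels control the difference of the values at `x` and `y`. -/
def Linked (x y : F) : Prop :=
  ∃ K : ℝ, 0 ≤ K ∧ ∀ (g : F → ℝ) (e : ℝ), S.levelEnergy H.A H.r 0 g ≤ e →
    S.levelEnergy H.A H.r 1 g ≤ e → (g x - g y) ^ 2 ≤ K * e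

variable {H}

theorem Linked.refl (x : F) : H.Linked x x := ⟨0, le_rfl, fun g e _ _ => by simp⟩

theorem Linked.trans {x y z : F} (h : H.Linked x y) (h' : H.Linked y z) : H.Linked x z := by
  obtain ⟨K, hK, h⟩ := h
  obtain ⟨L, hL, h'⟩ := h'
  refine ⟨2 * (K + L), by positivity, fun g e h0 h1 => ?_⟩
  have := h g e h0 h1
  have := h' g e h0 h1
  nlinarith [sq_nonneg ((g x - g y) - (g y - g z))]

theorem Linked.ψ {x y : F} (h : ∃ K : ℝ, 0 ≤ K ∧ ∀ (g : F → ℝ) (e : ℝ),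
    S.levelEnergy H.A H.r 0 g ≤ e → (g x - g y) ^ 2 ≤ K * e) (i : Fin M) :
    H.Linked (S.ψ i x) (S.ψ i y) := by
  obtain ⟨K, hK, h⟩ := h
  refine ⟨K * H.r i, mul_nonneg hK (H.r_pos i).le, fun g e _ h1 => ?_⟩
  rw [mul_assoc]
  refine h (g ∘ S.ψ i) _ ((H.levelEnergy_comp_le 0 g i).trans ?_)
  exact mul_le_mul_of_nonneg_left h1 (H.r_pos i).le

variable (H)

/-- Control spreads along edges of positive weight, and the graph is connected. -/
theorem exists_sq_sub_le_levelEnergy_zero {p q : F} (hp : p ∈ S.boundary)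
    (hq : q ∈ S.boundary) : ∃ K : ℝ, 0 ≤ K ∧ ∀ (g : F → ℝ) (e : ℝ),
      S.levelEnergy H.A H.r 0 g ≤ e → (g p - g q) ^ 2 ≤ K * e := by
  let U : Set S.boundary := {q | ∃ K : ℝ, 0 ≤ K ∧ ∀ (g : F → ℝ) (e : ℝ),
      S.levelEnergy H.A H.r 0 g ≤ e → (g p - g q) ^ 2 ≤ K * e}
  have hU : U = univ := by
    refine H.isLaplacian.eq_univ_of_closed U ⟨⟨p, hp⟩, 0, le_rfl, fun g e _ => by simp⟩ ?_
    rintro a ⟨K, hK, h⟩ b hab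
    refine ⟨2 * (K + 2 / H.A a b), by positivity, fun g e he => ?_⟩
    have h1 := h g e he
    rw [S.levelEnergy_zero] at he
    have h2 : H.A a b * (g a - g b) ^ 2 ≤ 2 * e :=
      (H.isLaplacian.mul_sq_sub_le (fun p => g p) a b).trans
        (mul_le_mul_of_nonneg_left he (by norm_num))
    have h3 : (g a - g b) ^ 2 ≤ 2 / H.A a b * e := by
      rw [div_mul_eq_mul_div, le_div_iff₀ hab]; linarith
    nlinarith [sq_nonneg ((g p - g a) - (g a - g b))]
  exact (hU ▸ mem_univ (⟨q, hq⟩ : S.boundary) : (⟨q, hq⟩ : S.boundary) ∈ U)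

theorem linked_ψ {p q : F} (hp : p ∈ S.boundary) (hq : q ∈ S.boundary) (i : Fin M) :
    H.Linked (S.ψ i p) (S.ψ i q) :=
  .ψ (H.exists_sq_sub_le_levelEnergy_zero hp hq) i

/-- If some cell were out of reach, a boundary link would lead from the reachable cells to the
others. -/
theorem linked_ψ_ψ {p : F} (hp : p ∈ S.boundary) (i j : Fin M) :
    H.Linked (S.ψ i p) (S.ψ j p) := by
  let I : Set (Fin M) := {j | H.Linked (S.ψ i p) (S.ψ j p)}
  by_contra hj
  obtain ⟨a, ha, b, hb, x, hx, y, hy, hxy⟩ :=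
    S.exists_boundary_link I ⟨i, Linked.refl _⟩ ⟨j, hj⟩
  refine hb (Linked.trans ha ((H.linked_ψ hp hx a).trans ?_))
  rw [hxy]
  exact H.linked_ψ hy hp b

theorem linked_boundary {p : F} (hp : p ∈ S.boundary) (i : Fin M) : H.Linked (S.ψ i p) p := by
  obtain ⟨j, q, hq, hqp⟩ := S.exists_ψ_eq_of_mem_boundary hp
  have := (H.linked_ψ_ψ hp i j).trans (H.linked_ψ hp hq j)
  rwa [hqp] at this

theorem exists_abs_sub_ψ_le {p : F} (hp : p ∈ S.boundary) :
    ∃ K : ℝ, 0 ≤ K ∧ ∀ (g : F → ℝ) (e : ℝ), 0 ≤ e → (∀ n, S.levelEnergy H.A H.r n g ≤ e ^ 2) →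
      ∀ i, |g (S.ψ i p) - g p| ≤ K * e := by
  choose K hK h using H.linked_boundary hp
  refine ⟨√(∑ i, K i), Real.sqrt_nonneg _, fun g e he hg i => ?_⟩
  have hs : K i ≤ ∑ i, K i := Finset.single_le_sum (fun i _ => hK i) (Finset.mem_univ i)
  rw [← Real.sqrt_sq he, ← Real.sqrt_mul' _ (sq_nonneg e)]
  refine Real.abs_le_sqrt ((h i g _ (hg 0) (hg 1)).trans ?_)
  gcongr

/-- Descending into the cell ψ_i replaces f by f ∘ ψ_i and e by s e, with s = √(max r), at the cost
K e of passing from ψ_i p to p. The unresolved difference sits in a set of diameter at most κ ^ n d.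
-/
theorem exists_abs_sub_le_of_level {p : F} (hp : p ∈ S.boundary) :
    ∃ K s κ d : ℝ, 0 ≤ K ∧ 0 ≤ s ∧ s < 1 ∧ 0 ≤ κ ∧ κ < 1 ∧ ∀ (n : ℕ) (f : F → ℝ) (e : ℝ), 0 ≤ e →
      (∀ n, S.levelEnergy H.A H.r n f ≤ e ^ 2) → ∀ x, ∃ y z, dist y z ≤ κ ^ n * d ∧
        |f x - f p| ≤ K * e * ∑ k ∈ Finset.range n, s ^ k + |f y - f z| := by
  obtain ⟨K, hK, hstep⟩ := H.exists_abs_sub_ψ_le hp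
  obtain ⟨κ, hκ, hL⟩ := S.exists_lipschitz
  have : Nonempty (Fin M) := ⟨⟨0, by have := S.two_le; omega⟩⟩
  obtain ⟨i₀, hi₀⟩ := Finite.exists_max H.r
  refine ⟨K, √(H.r i₀), κ, Metric.diam (univ : Set F), hK, Real.sqrt_nonneg _, ?_, κ.2,
    by exact_mod_cast hκ, fun n => ?_⟩
  · rw [Real.sqrt_lt' one_pos, one_pow]
    exact H.r_lt_one i₀
  induction n with
  | zero =>
    intro f e _ _ x
    refine ⟨x, p, ?_, by simp⟩
    simpa using Metric.dist_le_diam_of_mem isCompact_univ.isBounded (mem_univ x) (mem_univ p)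
  | succ n ih =>
    intro f e he hf x
    obtain ⟨i, x', rfl⟩ := S.exists_ψ_eq x
    obtain ⟨y, z, hyz, hle⟩ := ih (f ∘ S.ψ i) (√(H.r i₀) * e) (by positivity) (fun n => by
      rw [mul_pow, Real.sq_sqrt (H.r_pos i₀).le]
      refine (H.levelEnergy_comp_le n f i).trans ?_
      exact mul_le_mul (hi₀ i) (hf _) (H.levelEnergy_nonneg _ _) (H.r_pos i₀).le) x'
    refine ⟨S.ψ i y, S.ψ i z, ?_, ?_⟩
    · have h1 : dist (S.ψ i y) (S.ψ i z) ≤ κ * dist y z := by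
        simpa [SelfSimilarSet.wordMap] using (hL [i]).dist_le_mul y z
      rw [pow_succ', mul_assoc]
      exact h1.trans (mul_le_mul_of_nonneg_left hyz κ.2)
    · have h1 := hstep f e he hf i
      have h2 := abs_sub_le (f (S.ψ i x')) (f (S.ψ i p)) (f p)
      simp only [Function.comp_apply] at hle
      have h3 : K * e * ∑ k ∈ Finset.range (n + 1), √(H.r i₀) ^ k =
          K * (√(H.r i₀) * e) * ∑ k ∈ Finset.range n, √(H.r i₀) ^ k + K * e := by
        rw [Finset.sum_range_succ', mul_add, pow_zero, mul_one, Finset.mul_sum, Finset.mul_sum]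
        congr 1
        exact Finset.sum_congr rfl fun k _ => by ring
      linarith

/-- The energy of a continuous function controls its oscillation. -/
theorem exists_sq_sub_le : ∃ C : ℝ, 0 < C ∧ ∀ (f : F → ℝ), Continuous f → ∀ e : ℝ, 0 ≤ e →
    (∀ n, S.levelEnergy H.A H.r n f ≤ e) → ∀ x y, (f x - f y) ^ 2 ≤ C * e := by
  obtain ⟨p, hp⟩ := S.boundary_nonempty
  obtain ⟨K, s, κ, d, hK, hs0, hs1, hκ0, hκ1, h⟩ := H.exists_abs_sub_le_of_level hp
  have h1s : 0 < 1 - s := by linarith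
  have hmain : ∀ (f : F → ℝ), Continuous f → ∀ e : ℝ, 0 ≤ e →
      (∀ n, S.levelEnergy H.A H.r n f ≤ e ^ 2) → ∀ x, |f x - f p| ≤ K * e / (1 - s) := by
    intro f hf e he hfe x
    -- Uniform continuity makes the unresolved difference smaller than any ε at a deep enough level.
    refine le_of_forall_pos_le_add fun ε hε => ?_
    obtain ⟨δ, hδ, hfδ⟩ := Metric.uniformContinuous_iff.1
      (CompactSpace.uniformContinuous_of_continuous hf) ε hε
    have hlim : Filter.Tendsto (fun n : ℕ => κ ^ n * d) Filter.atTop (nhds 0) := by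
      simpa using (tendsto_pow_atTop_nhds_zero_of_lt_one hκ0 hκ1).mul_const d
    obtain ⟨n, hn⟩ := (hlim.eventually (gt_mem_nhds hδ)).exists
    obtain ⟨y, z, hyz, hle⟩ := h n f e he hfe x
    have h1 : |f y - f z| < ε := hfδ (hyz.trans_lt hn)
    have h2 : ∑ k ∈ Finset.range n, s ^ k ≤ (1 - s)⁻¹ := by
      rw [← tsum_geometric_of_lt_one hs0 hs1]
      exact (summable_geometric_of_lt_one hs0 hs1).sum_le_tsum _ fun k _ => by positivity
    have h3 : K * e * ∑ k ∈ Finset.range n, s ^ k ≤ K * e * (1 - s)⁻¹ := by gcongr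
    rw [div_eq_mul_inv]
    linarith
  -- The summand 1 only keeps the constant positive when K = 0.
  refine ⟨(2 * K / (1 - s)) ^ 2 + 1, by positivity, fun f hf e he hfe x y => ?_⟩
  have hfe' : ∀ n, S.levelEnergy H.A H.r n f ≤ √e ^ 2 := by rwa [Real.sq_sqrt he]
  have hx := hmain f hf _ (Real.sqrt_nonneg e) hfe' x
  have hy := hmain f hf _ (Real.sqrt_nonneg e) hfe' y
  have h1 : |f x - f y| ≤ 2 * K / (1 - s) * √e := by
    have := abs_sub_le (f x) (f p) (f y)
    rw [abs_sub_comm (f p)] at this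
    have h2 : 2 * K / (1 - s) * √e = K * √e / (1 - s) + K * √e / (1 - s) := by ring
    linarith
  calc (f x - f y) ^ 2 = |f x - f y| ^ 2 := (sq_abs _).symm
    _ ≤ (2 * K / (1 - s) * √e) ^ 2 := by gcongr
    _ = (2 * K / (1 - s)) ^ 2 * e := by rw [mul_pow, Real.sq_sqrt he]
    _ ≤ _ := by nlinarith

end RegularHarmonicStructure

end PCF

/-! ### The resistance metric: scaling and covering numbers. -/

namespace PCF

namespace RegularHarmonicStructure

variable {F : Type*} [MetricSpace F] [CompactSpace F] [ConnectedSpace F] {M : ℕ}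
  {S : PCFSelfSimilarSet F M} (H : RegularHarmonicStructure S)

theorem energy_le_ofReal_iff (f : C(F, ℝ)) {e : ℝ} (he : 0 ≤ e) :
    H.energy f ≤ ENNReal.ofReal e ↔ ∀ n, S.levelEnergy H.A H.r n f ≤ e := by
  simp [energy, ENNReal.ofReal_le_ofReal_iff he]

/-- The resistance is the best constant in `|f x - f y|² ≤ c 𝓔(f,f)`. -/
theorem resistance_le_ofReal_iff (x y : F) {c : ℝ} (hc : 0 ≤ c) :
    H.resistance x y ≤ ENNReal.ofReal c ↔ ∀ f : C(F, ℝ), ∀ e : ℝ, 0 ≤ e →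
      (∀ n, S.levelEnergy H.A H.r n f ≤ e) → (f x - f y) ^ 2 ≤ c * e := by
  have hinv : H.resistance x y ≤ ENNReal.ofReal c ↔ ∀ f : C(F, ℝ), f ∈ H.domain → f x = 0 →
      f y = 1 → (ENNReal.ofReal c)⁻¹ ≤ H.energy f := by
    rw [resistance, ← ENNReal.inv_le_inv, inv_inv, le_iInf₂_iff]
    exact ⟨fun h f h1 h2 h3 => h f ⟨h1, h2, h3⟩, fun h f hf => h f hf.1 hf.2.1 hf.2.2⟩
  rw [hinv]
  constructor
  · intro h f e he hfe
    by_cases hxy : f x = f y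
    · rw [hxy, sub_self]
      simpa using mul_nonneg hc he
    have hd : f y - f x ≠ 0 := sub_ne_zero.2 (Ne.symm hxy)
    -- The affine normalisation of f with value 0 at x and 1 at y.
    let g : C(F, ℝ) := ⟨fun z => (f y - f x)⁻¹ * (f z - f x), by fun_prop⟩
    have hg : H.energy g ≤ ENNReal.ofReal ((f y - f x)⁻¹ ^ 2 * e) := by
      rw [H.energy_le_ofReal_iff g (by positivity)]
      intro n
      have := S.levelEnergy_const_mul_sub H.A H.isLaplacian H.r n f (f y - f x)⁻¹ (f x)
      exact this.trans_le (mul_le_mul_of_nonneg_left (hfe n) (sq_nonneg _))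
    have h1 := (h g (hg.trans_lt ENNReal.ofReal_lt_top) (by simp [g]) (by simp [g, hd])).trans hg
    rw [ENNReal.inv_le_iff_le_mul (fun h => absurd h ENNReal.ofReal_ne_top)
      (fun h => absurd h ENNReal.ofReal_ne_top), ← ENNReal.ofReal_mul hc,
      ENNReal.one_le_ofReal, inv_pow] at h1
    have h2 : 0 < (f y - f x) ^ 2 := by positivity
    have h3 : c * (((f y - f x) ^ 2)⁻¹ * e) = c * e / (f y - f x) ^ 2 := by ring
    rw [h3, le_div_iff₀ h2, one_mul] at h1
    rwa [← neg_sub, neg_sq]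
  · intro h f hf hx hy
    have hfin : H.energy f ≠ ∞ := ne_of_lt hf
    have h1 := h f (H.energy f).toReal ENNReal.toReal_nonneg
      ((H.energy_le_ofReal_iff f ENNReal.toReal_nonneg).1 (by rw [ENNReal.ofReal_toReal hfin]))
    rw [hx, hy] at h1
    rw [ENNReal.inv_le_iff_le_mul (fun h => absurd h hfin)
      (fun h => absurd h ENNReal.ofReal_ne_top), ← ENNReal.ofReal_toReal hfin,
      ← ENNReal.ofReal_mul hc, ENNReal.one_le_ofReal]
    linarith

/-- The space is bounded in the resistance metric. -/
theorem exists_resistance_le :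
    ∃ C : ℝ, 0 < C ∧ ∀ x y, H.resistance x y ≤ ENNReal.ofReal C := by
  obtain ⟨C, hC, h⟩ := H.exists_sq_sub_le
  exact ⟨C, hC, fun x y => (H.resistance_le_ofReal_iff x y hC.le).2
    fun f e he hfe => h f f.continuous e he hfe x y⟩

theorem resistance_ne_top (x y : F) : H.resistance x y ≠ ∞ := by
  obtain ⟨C, -, h⟩ := H.exists_resistance_le
  exact ne_top_of_le_ne_top ENNReal.ofReal_ne_top (h x y)

theorem resistance_ψ_le (i : Fin M) {x y : F} {c : ℝ} (hc : 0 ≤ c)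
    (h : H.resistance x y ≤ ENNReal.ofReal c) :
    H.resistance (S.ψ i x) (S.ψ i y) ≤ ENNReal.ofReal (H.r i * c) := by
  have hr := (H.r_pos i).le
  rw [H.resistance_le_ofReal_iff _ _ (mul_nonneg hr hc)]
  intro f e he hfe
  rw [H.resistance_le_ofReal_iff _ _ hc] at h
  have := h (f.comp ⟨S.ψ i, (S.contracting i).choose_spec.2.continuous⟩) (H.r i * e)
    (mul_nonneg hr he) fun n =>
      (H.levelEnergy_comp_le n f i).trans (mul_le_mul_of_nonneg_left (hfe _) hr)
  refine this.trans_eq ?_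
  ring

/-- The square root of the resistance. -/
noncomputable def sqrtResistance (x y : F) : ℝ := √(H.resistance x y).toReal

theorem resistance_eq (x y : F) : H.resistance x y = ENNReal.ofReal (H.sqrtResistance x y ^ 2) := by
  rw [sqrtResistance, Real.sq_sqrt ENNReal.toReal_nonneg,
    ENNReal.ofReal_toReal (H.resistance_ne_top x y)]

theorem sqrtResistance_nonneg (x y : F) : 0 ≤ H.sqrtResistance x y := Real.sqrt_nonneg _

theorem sqrtResistance_le_iff (x y : F) {b : ℝ} (hb : 0 ≤ b) :
    H.sqrtResistance x y ≤ b ↔ H.resistance x y ≤ ENNReal.ofReal (b ^ 2) := by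
  rw [resistance_eq, ENNReal.ofReal_le_ofReal_iff (sq_nonneg b),
    sq_le_sq₀ (H.sqrtResistance_nonneg x y) hb]

theorem abs_sub_le_sqrtResistance (x y : F) (f : C(F, ℝ)) {e : ℝ} (he : 0 ≤ e)
    (hfe : ∀ n, S.levelEnergy H.A H.r n f ≤ e) : |f x - f y| ≤ H.sqrtResistance x y * √e := by
  have := (H.resistance_le_ofReal_iff x y (sq_nonneg (H.sqrtResistance x y))).1
    (H.resistance_eq x y).le f e he hfe
  rw [← Real.sqrt_sq (H.sqrtResistance_nonneg x y), ← Real.sqrt_mul (sq_nonneg _)]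
  exact Real.abs_le_sqrt this

theorem sqrtResistance_le_of_forall (x y : F) {b : ℝ} (hb : 0 ≤ b)
    (h : ∀ f : C(F, ℝ), ∀ e : ℝ, 0 ≤ e → (∀ n, S.levelEnergy H.A H.r n f ≤ e) →
      |f x - f y| ≤ b * √e) : H.sqrtResistance x y ≤ b := by
  rw [H.sqrtResistance_le_iff x y hb, H.resistance_le_ofReal_iff x y (sq_nonneg b)]
  intro f e he hfe
  calc (f x - f y) ^ 2 = |f x - f y| ^ 2 := (sq_abs _).symm
    _ ≤ (b * √e) ^ 2 := by gcongr; exact h f e he hfe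
    _ = b ^ 2 * e := by rw [mul_pow, Real.sq_sqrt he]

/-- The set `F` with the square root of the resistance metric as distance. -/
def ResistanceSpace (_ : RegularHarmonicStructure S) : Type _ := F

/-- As a best constant, the distance inherits symmetry and the triangle inequality from |f x - f y|.
-/
noncomputable instance : PseudoMetricSpace H.ResistanceSpace where
  dist := H.sqrtResistance
  dist_self x := le_antisymm
    (H.sqrtResistance_le_of_forall x x le_rfl fun f e _ _ => by simp)
    (H.sqrtResistance_nonneg x x)
  dist_comm x y := by
    have h : ∀ x y, H.sqrtResistance x y ≤ H.sqrtResistance y x := fun x y =>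
      H.sqrtResistance_le_of_forall x y (H.sqrtResistance_nonneg y x) fun f e he hfe => by
        rw [abs_sub_comm]
        exact H.abs_sub_le_sqrtResistance y x f he hfe
    exact le_antisymm (h x y) (h y x)
  dist_triangle x y z :=
    H.sqrtResistance_le_of_forall x z
      (add_nonneg (H.sqrtResistance_nonneg x y) (H.sqrtResistance_nonneg y z))
      fun f e he hfe => by
        have h1 := H.abs_sub_le_sqrtResistance x y f he hfe
        have h2 := H.abs_sub_le_sqrtResistance y z f he hfe
        have h3 := abs_sub_le (f x) (f y) (f z)
        rw [add_mul]
        linarith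

/-- The number of balls of radius `C ε` that cover `F` is at most of order `ε ^ (-d_H)`. -/
theorem exists_resistance_net {C : ℝ} (hC : 0 < C)
    (hdiam : ∀ x y, H.resistance x y ≤ ENNReal.ofReal C) :
    ∃ c : ℝ, 1 ≤ c ∧ ∀ ε : ℝ, 0 < ε → ε ≤ 1 → ∃ A : Finset F, (A.card : ℝ) ≤ c * ε ^ (-H.dH) ∧
      ∀ x, ∃ a ∈ A, H.resistance x a ≤ ENNReal.ofReal (C * ε) := by
  classical
  have : Nonempty (Fin M) := ⟨⟨0, by have := S.two_le; omega⟩⟩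
  obtain ⟨hd, hdsum⟩ : 0 < H.dH ∧ ∑ i, H.r i ^ H.dH = 1 := H.existsUnique_dim.choose_spec.1
  obtain ⟨i₀, hmin⟩ := Finite.exists_min H.r
  obtain ⟨i₁, hmax⟩ := Finite.exists_max H.r
  have hm := H.r_pos i₀
  have hm1 := (one_lt_inv₀ hm).2 (H.r_lt_one i₀)
  -- With this c, c ε ^ (-d_H) ≥ 1 for all ε up to 1 / min r, so one point is an admissible net in
  -- the base case.
  set c : ℝ := H.r i₀ ^ (-H.dH)
  have hc : 1 ≤ c :=
    Real.one_le_rpow_of_pos_of_le_one_of_nonpos hm (H.r_lt_one i₀).le (by linarith)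
  -- The range reaches 1 / min r because the recursion passes from ε < 1 to ε / r_i.
  have hnet : ∀ (n : ℕ) (ε : ℝ), 0 < ε → ε ≤ (H.r i₀)⁻¹ → H.r i₁ ^ n ≤ ε →
      ∃ A : Finset F, (A.card : ℝ) ≤ c * ε ^ (-H.dH) ∧
        ∀ x, ∃ a ∈ A, H.resistance x a ≤ ENNReal.ofReal (C * ε) := by
    intro n
    induction n with
    | zero =>
      intro ε hε hε' h1
      rw [pow_zero] at h1
      refine ⟨{Classical.arbitrary F}, ?_, fun x => ⟨_, Finset.mem_singleton_self _, ?_⟩⟩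
      · rw [Finset.card_singleton, Nat.cast_one, ← Real.mul_rpow hm.le hε.le]
        refine Real.one_le_rpow_of_pos_of_le_one_of_nonpos (by positivity) ?_ (by linarith)
        rwa [mul_comm, ← le_div_iff₀ hm, one_div]
      · exact (hdiam _ _).trans (ENNReal.ofReal_le_ofReal (by nlinarith))
    | succ n ih =>
      intro ε hε hε' h1
      by_cases hε1 : 1 ≤ ε
      · exact ih ε hε hε' ((pow_le_one₀ (H.r_pos i₁).le (H.r_lt_one i₁).le).trans hε1)
      have hstep : ∀ i, ∃ A : Finset F, (A.card : ℝ) ≤ c * (ε / H.r i) ^ (-H.dH) ∧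
          ∀ x, ∃ a ∈ A, H.resistance x a ≤ ENNReal.ofReal (C * (ε / H.r i)) := by
        intro i
        have hi := H.r_pos i
        refine ih _ (by positivity) ?_ ?_
        · rw [← one_div]
          exact div_le_div₀ zero_le_one (not_le.1 hε1).le hm (hmin i)
        · rw [le_div_iff₀ hi]
          rw [pow_succ] at h1
          exact (mul_le_mul_of_nonneg_left (hmax i) (pow_nonneg (H.r_pos i₁).le n)).trans h1
      choose A hcard hA using hstep
      -- The images of nets at scale ε / r_i form a net at scale ε; the cardinalities add up through
      -- ∑ r_i ^ d_H = 1.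
      refine ⟨Finset.univ.biUnion fun i => (A i).image (S.ψ i), ?_, fun x => ?_⟩
      · calc ((Finset.univ.biUnion fun i => (A i).image (S.ψ i)).card : ℝ)
            ≤ ∑ i, ((A i).card : ℝ) := by
              exact_mod_cast Finset.card_biUnion_le.trans
                (Finset.sum_le_sum fun i _ => Finset.card_image_le)
          _ ≤ ∑ i, c * (ε / H.r i) ^ (-H.dH) := Finset.sum_le_sum fun i _ => hcard i
          _ = ∑ i, c * ε ^ (-H.dH) * H.r i ^ H.dH := Finset.sum_congr rfl fun i _ => by
              rw [Real.div_rpow hε.le (H.r_pos i).le, Real.rpow_neg (H.r_pos i).le, div_inv_eq_mul,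
                mul_assoc]
          _ = c * ε ^ (-H.dH) := by rw [← Finset.mul_sum, hdsum, mul_one]
      · obtain ⟨i, y, rfl⟩ := S.exists_ψ_eq x
        obtain ⟨a, ha, hya⟩ := hA i y
        have hi := H.r_pos i
        refine ⟨S.ψ i a, Finset.mem_biUnion.2
          ⟨i, Finset.mem_univ i, Finset.mem_image_of_mem _ ha⟩, ?_⟩
        refine (H.resistance_ψ_le i (by positivity) hya).trans_eq ?_
        congr 1
        field_simp
  refine ⟨c, hc, fun ε hε hε1 => ?_⟩
  obtain ⟨n, hn⟩ := exists_pow_lt_of_lt_one hε (H.r_lt_one i₁)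
  exact hnet n ε hε (hε1.trans hm1.le) hn.le

end RegularHarmonicStructure

end PCF

/-! ### The continuity theorem for the resistance metric. -/

theorem mainTheorem6
    {F : Type*} [MetricSpace F] [CompactSpace F] [ConnectedSpace F] {M : ℕ}
    (S : PCF.PCFSelfSimilarSet F M) (H : PCF.RegularHarmonicStructure S)
    {E : Type*} [MetricSpace E] [CompleteSpace E] [TopologicalSpace.SeparableSpace E]
    [MeasurableSpace E] [BorelSpace E]
    {Ω : Type*} [MeasurableSpace Ω] (P : Measure Ω) [IsProbabilityMeasure P]
    (ξ : F → Ω → E) (hξ : ∀ x, Measurable (ξ x))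
    (C β γ : ℝ) (hC : 0 < C) (hβ : 0 < β) (hγ : 0 < γ)
    (hmoment : ∀ x y, ∫⁻ ω, edist (ξ x ω) (ξ y ω) ^ β ∂P
      ≤ ENNReal.ofReal C * H.resistance x y ^ (H.dH + γ)) :
    ∃ η : F → Ω → E, (∀ x, Measurable (η x)) ∧ (∀ x, η x =ᵐ[P] ξ x) ∧
      ∀ᵐ ω ∂P, PCF.EssentiallyHolder H.resistance (γ / β) (fun x => η x ω) := by
  have : SecondCountableTopology E := UniformSpace.secondCountable_of_separable E
  obtain ⟨D, hD, hdiam⟩ := H.exists_resistance_le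
  obtain ⟨c, hc, hnet⟩ := H.exists_resistance_net hD hdiam
  have hdH : 0 < H.dH := H.existsUnique_dim.choose_spec.1.1
  have hpow : ∀ (x y : F) {q : ℝ}, 0 ≤ q →
      H.resistance x y ^ q = ENNReal.ofReal (H.sqrtResistance x y ^ (2 * q)) := by
    intro x y q hq
    rw [H.resistance_eq, ENNReal.ofReal_rpow_of_nonneg (sq_nonneg _) hq,
      Real.rpow_mul (H.sqrtResistance_nonneg x y), Real.rpow_ofNat]
  -- Scale 4⁻ⁿ for R is scale 2⁻ⁿ for √R.
  choose A hcard hA using fun n : ℕ =>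
    hnet ((1 / 4) ^ n) (by positivity) (pow_le_one₀ (by norm_num) (by norm_num))
  have hquarter : ∀ n : ℕ, D * (1 / 4) ^ n = (√D * (1 / 2) ^ n) ^ 2 := by
    intro n
    rw [mul_pow, Real.sq_sqrt hD.le, ← pow_mul, mul_comm n, pow_mul]
    norm_num
  obtain ⟨η, hη, hηξ, hηH⟩ := KolmogorovChaining.exists_holder_version
    (T := H.ResistanceSpace) (P := P) (X := ξ) hξ (β := β) (γ := 2 * γ) (D := 2 * H.dH)
    (C := C) hβ (by positivity) (by positivity) hC.le
    (fun s t => by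
      refine (hmoment s t).trans_eq ?_
      rw [hpow s t (by positivity), ← ENNReal.ofReal_mul hC.le, mul_add]
      rfl)
    (A := A) hc
    (fun n => by
      refine (hcard n).trans_eq ?_
      congr 1
      rw [← Real.rpow_natCast, ← Real.rpow_natCast, ← Real.rpow_mul (by norm_num),
        ← Real.rpow_mul (by norm_num), show (1 / 4 : ℝ) = 2 ^ (-2 : ℝ) by
          rw [Real.rpow_neg (by norm_num)]; norm_num, ← Real.rpow_mul (by norm_num)]
      congr 1
      ring)
    (D₀ := √D) (Real.sqrt_pos.2 hD)
    (fun s t => (H.sqrtResistance_le_iff s t (Real.sqrt_nonneg D)).2 (by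
      rw [Real.sq_sqrt hD.le]; exact hdiam s t))
    (fun n t => by
      obtain ⟨a, ha, hta⟩ := hA n t
      rw [hquarter] at hta
      exact ⟨a, ha, (H.sqrtResistance_le_iff t a (by positivity)).2 hta⟩)
  refine ⟨η, hη, hηξ, ?_⟩
  filter_upwards [hηH] with ω hω θ hθ hθ'
  -- Exponent 2θ for √R is exponent θ for R.
  obtain ⟨L, hL0, hL⟩ := hω (2 * θ) (by positivity) (by
    rw [mul_div_assoc]; linarith)
  refine ⟨L.toNNReal, fun x y => ?_⟩
  have h : edist (η x ω) (η y ω) ≤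
      ENNReal.ofReal (L * H.sqrtResistance x y ^ (2 * θ)) := by
    rw [edist_dist]
    exact ENNReal.ofReal_le_ofReal (hL x y)
  rw [ENNReal.ofReal_mul hL0, ← hpow x y hθ.le] at h
  exact h
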